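/- Theorem 4.4. For every integer $m\ge 0$ the infinite recurrent series $$S_m=\sum_{1\le N_1\le N_2\le\cdots\le N_m}\frac{1}{N_m^2\cdots N_2^2N_1^2},$$ taken over all $m$-tuples of positive integers with $N_1\le N_2\le\cdots\le N_m$ (for $m=0$ the empty tuple contributes the single term $1$), converges, and $$\lim_{m\to\infty}S_m=2.$$ -/

import Mathlib

open Filter Topology

/-- The index set of the infinite recurrent series of order `m`: the tuples of positive integers
`1 ≤ N 0 ≤ N 1 ≤ ⋯ ≤ N (m - 1)`; here `N i` plays the role of `N_{i+1}`.
For `m = 0` it consists of the empty tuple only. -/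
def RecurrentIndex (m : ℕ) : Set (Fin m → ℕ) :=
  {N | Monotone N ∧ ∀ i, 1 ≤ N i}

/-- The term `1 / (N_m ^ 2 ⋯ N_1 ^ 2)` of the recurrent series of order `m`. -/
noncomputable def recurrentTerm (m : ℕ) (N : RecurrentIndex m) : ℝ :=
  ∏ i : Fin m, 1 / ((N : Fin m → ℕ) i : ℝ) ^ 2

/-- The infinite recurrent series
`∑_{1 ≤ N_1 ≤ ⋯ ≤ N_m} 1 / (N_m ^ 2 ⋯ N_1 ^ 2)` of order `m`. -/
noncomputable def recurrentSeries (m : ℕ) : ℝ :=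
  ∑' N : RecurrentIndex m, recurrentTerm m N

/-!
Write `h(m, M)` for the sum of `1 / (N_1 ^ 2 ⋯ N_m ^ 2)` over the tuples
`1 ≤ N_1 ≤ ⋯ ≤ N_m ≤ M`, that is, the complete homogeneous symmetric polynomial of degree `m` in
`1, 1/4, …, 1/M ^ 2`. Splitting according to whether `N_m = M` gives
`h(m + 1, M + 1) = h(m + 1, M) + h(m, M + 1) / (M + 1) ^ 2` (`truncatedSeries_succ_succ`).

Since `h(m, M)` is the `m`-th coefficient of `∏_{n ≤ M} (1 - x / n ^ 2)⁻¹`, whose pole of smallest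
modulus is `x = 1`, for fixed `M ≥ 1` it tends to `∏_{2 ≤ n ≤ M} (1 - 1 / n ^ 2)⁻¹ = 2 M / (M + 1)`. Both
`h(m, M) ≤ 2 M / (M + 1)` (`truncatedSeries_le`) and the quantitative lower bound
`2 M / (M + 1) - 2 ^ (M - 1) / 2 ^ m ≤ h(m, M)` (`le_truncatedSeries`) follow from the recursion, because
the sequence `2 M / (M + 1)` satisfies the same recursion with no dependence on `m`. The upper bound
is at most `2` uniformly in `M`, which gives convergence of the series and `S_m ≤ 2`. The lower
bound gives `liminf S_m ≥ 2 M / (M + 1)` for each `M`, hence the limit `2`.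
-/

/-- The tuples `1 ≤ N 0 ≤ ⋯ ≤ N (m - 1) ≤ M`, as a finite set. -/
noncomputable def truncatedIndex (m M : ℕ) : Finset (Fin m → ℕ) :=
  open Classical in (Fintype.piFinset fun _ => Finset.Icc 1 M).filter Monotone

/-- The part of the recurrent series of order `m` that comes from the tuples with entries at most
`M`. -/
noncomputable def truncatedSeries (m M : ℕ) : ℝ :=
  ∑ N ∈ truncatedIndex m M, ∏ i : Fin m, 1 / (N i : ℝ) ^ 2

theorem mem_truncatedIndex {m M : ℕ} {N : Fin m → ℕ} :
    N ∈ truncatedIndex m M ↔ N ∈ RecurrentIndex m ∧ ∀ i, N i ≤ M := by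
  simp only [truncatedIndex, RecurrentIndex, Finset.mem_filter, Fintype.mem_piFinset,
    Finset.mem_Icc, Set.mem_ofPred_eq, forall_and]
  tauto

theorem snoc_mem_truncatedIndex {m M : ℕ} {N : Fin m → ℕ} :
    (Fin.snoc N (M + 1) : Fin (m + 1) → ℕ) ∈ truncatedIndex (m + 1) (M + 1) ↔
      N ∈ truncatedIndex m (M + 1) := by
  simp only [mem_truncatedIndex, RecurrentIndex, Set.mem_ofPred_eq, Fin.forall_fin_succ',
    Fin.snoc_castSucc, Fin.snoc_last, le_refl, and_true, le_add_iff_nonneg_left, zero_le]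
  constructor
  · rintro ⟨⟨hmono, hpos⟩, hle⟩
    refine ⟨⟨fun i j hij => ?_, hpos⟩, hle⟩
    simpa using hmono (Fin.castSucc_le_castSucc_iff.2 hij)
  · rintro ⟨⟨hmono, hpos⟩, hle⟩
    refine ⟨⟨fun i j hij => ?_, hpos⟩, hle⟩
    induction j using Fin.lastCases with
    | last =>
      induction i using Fin.lastCases with
      | last => exact le_rfl
      | cast i => simpa using hle i
    | cast j =>
      induction i using Fin.lastCases with
      | last => exact absurd (Fin.castSucc_lt_last j) (not_lt.2 hij)
      | cast i => simpa using hmono (Fin.castSucc_le_castSucc_iff.1 hij)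

/-- A monotone tuple bounded by `M + 1` is either bounded by `M`, or ends in `M + 1`. -/
theorem truncatedSeries_succ_succ (m M : ℕ) :
    truncatedSeries (m + 1) (M + 1) =
      truncatedSeries (m + 1) M + truncatedSeries m (M + 1) / ((M : ℝ) + 1) ^ 2 := by
  classical
  have hsplit : truncatedIndex (m + 1) (M + 1) = truncatedIndex (m + 1) M ∪
      (truncatedIndex m (M + 1)).image fun N => (Fin.snoc N (M + 1) : Fin (m + 1) → ℕ) := by
    ext N
    simp only [Finset.mem_union, Finset.mem_image]
    constructor
    · intro hN
      by_cases hlast : N (Fin.last m) = M + 1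
      · have hsnoc : (Fin.snoc (Fin.init N) (M + 1) : Fin (m + 1) → ℕ) = N := by
          rw [← hlast, Fin.snoc_init_self]
        exact Or.inr ⟨Fin.init N, snoc_mem_truncatedIndex.1 (hsnoc.symm ▸ hN), hsnoc⟩
      · rw [mem_truncatedIndex] at hN
        refine Or.inl (mem_truncatedIndex.2 ⟨hN.1, fun i => ?_⟩)
        have h₁ := hN.1.1 (Fin.le_last i)
        have h₂ := hN.2 (Fin.last m)
        omega
    · rintro (hN | ⟨N, hN, rfl⟩)
      · rw [mem_truncatedIndex] at hN ⊢
        exact ⟨hN.1, fun i => (hN.2 i).trans (Nat.le_succ M)⟩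
      · exact snoc_mem_truncatedIndex.2 hN
  have hdisj : Disjoint (truncatedIndex (m + 1) M)
      ((truncatedIndex m (M + 1)).image fun N => (Fin.snoc N (M + 1) : Fin (m + 1) → ℕ)) := by
    rw [Finset.disjoint_left]
    intro N hN hN'
    obtain ⟨N, -, rfl⟩ := Finset.mem_image.1 hN'
    simpa using (mem_truncatedIndex.1 hN).2 (Fin.last m)
  rw [truncatedSeries, hsplit, Finset.sum_union hdisj, Finset.sum_image]
  · simp only [truncatedSeries, Fin.prod_univ_castSucc, Fin.snoc_castSucc, Fin.snoc_last,
      Finset.sum_div]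
    push_cast
    simp only [mul_one_div]
  · intro N _ N' _ h
    simpa using congrArg (Fin.init (α := fun _ => ℕ)) h

theorem truncatedSeries_zero_left (M : ℕ) : truncatedSeries 0 M = 1 := by
  have h : truncatedIndex 0 M = Finset.univ := by
    ext N
    simp [mem_truncatedIndex, RecurrentIndex, Subsingleton.monotone, eq_iff_true_of_subsingleton]
  simp [truncatedSeries, h]

theorem truncatedSeries_succ_zero (m : ℕ) : truncatedSeries (m + 1) 0 = 0 := by
  refine Finset.sum_eq_zero fun N hN => ?_
  have h := mem_truncatedIndex.1 hN
  exact absurd ((h.1.2 0).trans (h.2 0)) (by norm_num)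

/-- The limits `2 (M + 1) / (M + 2)` satisfy the recursion of `truncatedSeries_succ_succ` with
the dependence on `m` dropped. -/
theorem two_mul_div_succ (M : ℕ) :
    2 * ((M : ℝ) + 2) / (M + 3) =
      2 * (M + 1) / (M + 2) + 2 * (M + 2) / (M + 3) / ((M : ℝ) + 2) ^ 2 := by
  field_simp
  ring

theorem truncatedSeries_one_right (m : ℕ) : truncatedSeries m 1 = 1 := by
  induction m with
  | zero => exact truncatedSeries_zero_left 1
  | succ m ih =>
    have h := truncatedSeries_succ_succ m 0
    rw [zero_add, ih, truncatedSeries_succ_zero] at h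
    simpa using h

/-- The bound is stated for `M + 1`, since `h(0, 0) = 1` exceeds `2 * 0 / (0 + 1)`. -/
theorem truncatedSeries_le (m M : ℕ) :
    truncatedSeries m (M + 1) ≤ 2 * ((M : ℝ) + 1) / (M + 2) := by
  induction M generalizing m with
  | zero => simp [truncatedSeries_one_right]
  | succ M ihM =>
    have hM : (0 : ℝ) ≤ M := M.cast_nonneg
    have hcast : 2 * (((M + 1 : ℕ) : ℝ) + 1) / (((M + 1 : ℕ) : ℝ) + 2) =
        2 * ((M : ℝ) + 2) / (M + 3) := by
      push_cast
      ring
    rw [hcast]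
    induction m with
    | zero =>
      rw [truncatedSeries_zero_left, le_div_iff₀ (by positivity)]
      linarith
    | succ m ihm =>
      rw [truncatedSeries_succ_succ, two_mul_div_succ]
      push_cast
      rw [show (M : ℝ) + 1 + 1 = M + 2 by ring]
      gcongr
      exact ihM (m + 1)

/-- The deviation from the limit satisfies the recursion of `truncatedSeries_succ_succ`. As the
weight `1 / (M + 2) ^ 2` is at most `1 / 4`, so does `2 ^ M / 2 ^ m`, as an inequality. -/
theorem le_truncatedSeries (m M : ℕ) :
    2 * ((M : ℝ) + 1) / (M + 2) - 2 ^ M / 2 ^ m ≤ truncatedSeries m (M + 1) := by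
  induction M generalizing m with
  | zero =>
    simp [truncatedSeries_one_right]
  | succ M ihM =>
    have hM : (0 : ℝ) ≤ M := M.cast_nonneg
    have hcast : 2 * (((M + 1 : ℕ) : ℝ) + 1) / (((M + 1 : ℕ) : ℝ) + 2) =
        2 * ((M : ℝ) + 2) / (M + 3) := by
      push_cast
      ring
    rw [hcast]
    induction m with
    | zero =>
      have h₁ : 2 * ((M : ℝ) + 2) / (M + 3) ≤ 2 := by
        rw [div_le_iff₀ (by positivity)]
        linarith
      have h₂ : (1 : ℝ) ≤ 2 ^ M := one_le_pow₀ one_le_two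
      rw [truncatedSeries_zero_left, pow_succ, pow_zero, div_one]
      linarith
    | succ m ihm =>
      have hweight : (2 : ℝ) ^ (M + 1) / 2 ^ m / ((M : ℝ) + 2) ^ 2 ≤
          2 ^ (M + 1) / 2 ^ m / 4 := by
        gcongr
        nlinarith
      have hstep := div_le_div_of_nonneg_right ihm (sq_nonneg ((M : ℝ) + 2))
      rw [sub_div] at hstep
      have hprev := ihM (m + 1)
      have hpow : (2 : ℝ) ^ (M + 1) / 2 ^ (m + 1) =
          2 ^ M / 2 ^ (m + 1) + 2 ^ (M + 1) / 2 ^ m / 4 := by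
        field_simp
        ring
      rw [truncatedSeries_succ_succ, two_mul_div_succ]
      push_cast
      rw [show (M : ℝ) + 1 + 1 = M + 2 by ring]
      linarith

theorem truncatedSeries_le_two (m M : ℕ) : truncatedSeries m (M + 1) ≤ 2 := by
  refine (truncatedSeries_le m M).trans ?_
  rw [div_le_iff₀ (by positivity)]
  linarith

theorem recurrentTerm_nonneg (m : ℕ) (N : RecurrentIndex m) : 0 ≤ recurrentTerm m N :=
  Finset.prod_nonneg fun _ _ => by positivity

/-- A finite set of tuples has bounded entries, so every finite partial sum is dominated by a
truncated series. -/
theorem sum_recurrentTerm_le_two (m : ℕ) (s : Finset (RecurrentIndex m)) :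
    ∑ N ∈ s, recurrentTerm m N ≤ 2 := by
  set M := s.sup fun N => Finset.univ.sup N.1
  have hsub : s.map (Function.Embedding.subtype _) ⊆ truncatedIndex m (M + 1) := by
    intro N hN
    obtain ⟨N, hNs, rfl⟩ := Finset.mem_map.1 hN
    refine mem_truncatedIndex.2 ⟨N.2, fun i => Nat.le_succ_of_le ?_⟩
    exact (Finset.le_sup (f := N.1) (Finset.mem_univ i)).trans
      (Finset.le_sup (f := fun N : RecurrentIndex m => Finset.univ.sup N.1) hNs)
  calc ∑ N ∈ s, recurrentTerm m N
      = ∑ N ∈ s.map (Function.Embedding.subtype _), ∏ i : Fin m, 1 / (N i : ℝ) ^ 2 := by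
        rw [Finset.sum_map]
        rfl
    _ ≤ truncatedSeries m (M + 1) :=
        Finset.sum_le_sum_of_subset_of_nonneg hsub fun _ _ _ =>
          Finset.prod_nonneg fun _ _ => by positivity
    _ ≤ 2 := truncatedSeries_le_two m M

theorem summable_recurrentTerm (m : ℕ) : Summable (recurrentTerm m) :=
  summable_of_sum_le (recurrentTerm_nonneg m) (sum_recurrentTerm_le_two m)

theorem recurrentSeries_le_two (m : ℕ) : recurrentSeries m ≤ 2 :=
  (summable_recurrentTerm m).tsum_le_of_sum_le (sum_recurrentTerm_le_two m)

theorem truncatedSeries_le_recurrentSeries (m M : ℕ) :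
    truncatedSeries m M ≤ recurrentSeries m := by
  classical
  have h : truncatedSeries m M =
      ∑ N ∈ (truncatedIndex m M).subtype (· ∈ RecurrentIndex m), recurrentTerm m N :=
    (Finset.sum_subtype_of_mem (fun N : Fin m → ℕ => ∏ i : Fin m, 1 / (N i : ℝ) ^ 2)
      fun _ hN => (mem_truncatedIndex.1 hN).1).symm
  rw [h]
  exact (summable_recurrentTerm m).sum_le_tsum _ fun N _ => recurrentTerm_nonneg m N

theorem theorem4p4 :
    (∀ m : ℕ, Summable (recurrentTerm m)) ∧
      Tendsto (fun m : ℕ => recurrentSeries m) atTop (𝓝 2) := by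
  refine ⟨summable_recurrentTerm, tendsto_order.2 ⟨fun a ha => ?_, fun a ha =>
    Eventually.of_forall fun m => (recurrentSeries_le_two m).trans_lt ha⟩⟩
  -- As `2 - 2 (M + 1) / (M + 2) < 2 / (M + 1)`, a large `M` brings the limit of the truncated
  -- series above `a`.
  obtain ⟨M, hM⟩ := exists_nat_one_div_lt (show 0 < (2 - a) / 2 by linarith)
  have hlim : a < 2 * ((M : ℝ) + 1) / (M + 2) := by
    rw [div_lt_iff₀ (by positivity)] at hM
    rw [lt_div_iff₀ (by positivity)]
    linarith
  have htendsto : Tendsto (fun m : ℕ => 2 * ((M : ℝ) + 1) / (M + 2) - 2 ^ M / 2 ^ m) atTop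
      (𝓝 (2 * ((M : ℝ) + 1) / (M + 2) - 0)) :=
    tendsto_const_nhds.sub
      (tendsto_const_nhds.div_atTop (tendsto_pow_atTop_atTop_of_one_lt one_lt_two))
  rw [sub_zero] at htendsto
  filter_upwards [htendsto.eventually_const_lt hlim] with m hm
  exact hm.trans_le ((le_truncatedSeries m M).trans (truncatedSeries_le_recurrentSeries m _))
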